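/- **Setting.** Let $N,d,K,T$ be natural numbers, $\lambda>0$ and $\gamma_U,\gamma_D\ge 1$. On a probability space, at each time $t=1,\dots,T$ a (random) client $i_t\in\{1,\dots,N\}$ is active and is shown random context vectors $\mathbf x_{t,1},\dots,\mathbf x_{t,K}\in\mathbb R^d$ with $\|\mathbf x_{t,a}\|_2\le 1$ almost surely; it chooses one of them by an arbitrary rule (any measurable random choice), and the chosen vector is denoted $\mathbf x_t$. Let $\eta_t$ be the (real random) reward noise at time $t$. For a matrix $A\in\mathbb R^{d\times d}$ write $A(\lambda)=A+\lambda I$. **Protocol.** Every client $i$ keeps matrices $V_i$ and $\Delta V_i$ (upload buffer); the server keeps $V_g$ and, for every client $j$, a download buffer $\Delta V_{-j}$. All of them, for all $N$ clients, are $0$ at time $0$. At time $t$: 1. the active client adds $\mathbf x_t\mathbf x_t^\top$ to $V_{i_t}$ and to $\Delta V_{i_t}$; 2. if the upload event $\det V_{i_t}(\lambda)/\det\big((V_{i_t}-\Delta V_{i_t})(\lambda)\big)>\gamma_U$ happens, then $\Delta V_{i_t}$ is added to $V_g$ and to $\Delta V_{-j}$ for all $j\ne i_t$, then $\Delta V_{i_t}$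 is set to $0$, and then, for every client $j$ for which the download event $\det V_g(\lambda)/\det\big((V_g-\Delta V_{-j})(\lambda)\big)>\gamma_D$ happens, $\Delta V_{-j}$ is added to $V_j$ and set to $0$. If the upload event does not happen, nothing more is done at time $t$. Let $V_{i,t}$ be the value of $V_i$ at the end of time $t$, let $V_t=\sum_{s=1}^t\mathbf x_s\mathbf x_s^\top$, and $$\Gamma_{t-1}=\frac{\mathbf x_t^\top V_{i_t,t-1}(\lambda)^{-1}\mathbf x_t}{\mathbf x_t^\top V_{t-1}(\lambda)^{-1}\mathbf x_t}\qquad(\Gamma_{t-1}:=0\text{ if }\mathbf x_t=0).$$ **Context regularity.** There are a constant $\lambda_c>0$ and a matrix $\Sigma_c\succeq\lambda_c I$ such that for all $t\in\{1,\dots,T\}$ and all arms $a$, almost surely, $$\mathbb E\big[\mathbf x_{t,a}\mathbf x_{t,a}^\top\,\big|\,\{i_s,(\mathbf x_{s,1},\dots,\mathbf x_{s,K}),\eta_s\}_{1\le s\le t-1}\big]=\Sigma_c .$$ **Lemma 1.** Under these assumptions, for every $\delta\in(0,1)$, with probability at least $1-\delta$, $$\Gamma_{t-1}\le\frac{8\gamma_D}{\lambda_c}\,\big[1+(N-1)(\gamma_U-1)\big]\qquad\text{for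 all } t\in\{1,\dots,T\}\text{ simultaneously.}$$ -/

import Mathlib

open MeasureTheory

namespace AsyncBandit

/-- State of the event-triggered protocol with `N` clients in dimension `d`.
All stored matrices are unregularised sums of `x xᵀ`. (The vectors `b` are communicated together
with the matrices but influence neither the triggers nor the matrices.) -/
structure ProtocolState (N d : ℕ) where
  /-- local statistics `V_i` of client `i` -/
  V : Fin N → Matrix (Fin d) (Fin d) ℝ
  /-- upload buffer `ΔV_i` of client `i` -/
  up : Fin N → Matrix (Fin d) (Fin d) ℝ
  /-- the server's aggregated statistics `V_g` -/
  Vg : Matrix (Fin d) (Fin d) ℝ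
  /-- the server's download buffer `ΔV_{-j}` for client `j` -/
  down : Fin N → Matrix (Fin d) (Fin d) ℝ

variable {N d : ℕ}

/-- All clients, the server and all buffers start from zero. -/
def initState (N d : ℕ) : ProtocolState N d where
  V _ := 0
  up _ := 0
  Vg := 0
  down _ := 0

/-- The regularised matrix `V(lam) = V + lam I`. -/
def reg (lam : ℝ) (A : Matrix (Fin d) (Fin d) ℝ) : Matrix (Fin d) (Fin d) ℝ :=
  A + lam • (1 : Matrix (Fin d) (Fin d) ℝ)

/-- The rank-one matrix `x xᵀ`. -/
def outer (x : EuclideanSpace ℝ (Fin d)) : Matrix (Fin d) (Fin d) ℝ :=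
  Matrix.of fun j k => x j * x k

/-- The quadratic form `xᵀ A x`. -/
def quad (A : Matrix (Fin d) (Fin d) ℝ) (x : EuclideanSpace ℝ (Fin d)) : ℝ :=
  ∑ j, ∑ k, x j * A j k * x k

/-- The active client `i` adds `x xᵀ` to its statistics and to its upload buffer. -/
def ProtocolState.observe (S : ProtocolState N d) (i : Fin N) (x : EuclideanSpace ℝ (Fin d)) :
    ProtocolState N d where
  V := Function.update S.V i (S.V i + outer x)
  up := Function.update S.up i (S.up i + outer x)
  Vg := S.Vg
  down := S.down

/-- The upload event of client `i`: `det V_i / det (V_i - ΔV_i) > γU` (regularised). -/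
def ProtocolState.UploadEvent (S : ProtocolState N d) (lam γU : ℝ) (i : Fin N) : Prop :=
  γU < (reg lam (S.V i)).det / (reg lam (S.V i - S.up i)).det

/-- The download event of client `j`: `det V_g / det (V_g - ΔV_{-j}) > γD` (regularised). -/
def ProtocolState.DownloadEvent (S : ProtocolState N d) (lam γD : ℝ) (j : Fin N) : Prop :=
  γD < (reg lam S.Vg).det / (reg lam (S.Vg - S.down j)).det

/-- Client `i` sends its upload buffer: the server adds it to `V_g` and to the download buffers of
all the other clients, and the upload buffer is emptied. -/
def ProtocolState.upload (S : ProtocolState N d) (i : Fin N) : ProtocolState N d where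
  V := S.V
  up := Function.update S.up i 0
  Vg := S.Vg + S.up i
  down j := if j = i then S.down j else S.down j + S.up i

open Classical in
/-- Every client `j` whose download event happens receives its download buffer, which is
emptied. The events for different `j` do not influence each other. -/
noncomputable def ProtocolState.download (S : ProtocolState N d) (lam γD : ℝ) :
    ProtocolState N d where
  V j := if S.DownloadEvent lam γD j then S.V j + S.down j else S.V j
  up := S.up
  Vg := S.Vg
  down j := if S.DownloadEvent lam γD j then 0 else S.down j

open Classical in
/-- The communication protocol run after client `i` has been active: if the upload event
happens, client `i` uploads and then the server performs the triggered downloads. -/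
noncomputable def ProtocolState.communicate (S : ProtocolState N d) (lam γU γD : ℝ) (i : Fin N) :
    ProtocolState N d :=
  if S.UploadEvent lam γU i then (S.upload i).download lam γD else S

/-- The state at the end of time step `t` when at each time `s ≥ 1` client `i s` is active and its
chosen context vector is `x s`. -/
noncomputable def run (lam γU γD : ℝ) (i : ℕ → Fin N) (x : ℕ → EuclideanSpace ℝ (Fin d)) :
    ℕ → ProtocolState N d
  | 0 => initState N d
  | t + 1 => ((run lam γU γD i x t).observe (i (t + 1)) (x (t + 1))).communicate
      lam γU γD (i (t + 1))

/-- The centralised statistics `V_t = ∑_{s=1}^t x_s x_sᵀ`. -/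
def central (x : ℕ → EuclideanSpace ℝ (Fin d)) (t : ℕ) : Matrix (Fin d) (Fin d) ℝ :=
  ∑ s ∈ Finset.Icc 1 t, outer (x s)

/-- The width ratio at time `t ≥ 1` (the paper's `Γ_{t-1}`),
`xₜᵀ V_{iₜ,t-1}(lam)⁻¹ xₜ / xₜᵀ V_{t-1}(lam)⁻¹ xₜ`; it is `0` if `xₜ = 0`. -/
noncomputable def widthRatio (lam γU γD : ℝ) (i : ℕ → Fin N) (x : ℕ → EuclideanSpace ℝ (Fin d))
    (t : ℕ) : ℝ :=
  quad (reg lam ((run lam γU γD i x (t - 1)).V (i t)))⁻¹ (x t) /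
    quad (reg lam (central x (t - 1)))⁻¹ (x t)

/-- The history before time `t`: the σ-algebra generated by the active clients, the sets of
context vectors and the noises at the times `1, …, t - 1`. -/
def history {Ω : Type*} {K : ℕ} (i : ℕ → Ω → Fin N)
    (ctx : ℕ → Fin K → Ω → EuclideanSpace ℝ (Fin d)) (η : ℕ → Ω → ℝ) (t : ℕ) :
    MeasurableSpace Ω :=
  ⨆ s ∈ Finset.Ico 1 t,
    MeasurableSpace.comap (i s) inferInstance ⊔
    MeasurableSpace.comap (fun ω a => ctx s a ω) inferInstance ⊔
    MeasurableSpace.comap (η s) inferInstance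

/-- Context regularity up to the horizon `T`: for each arm and time, the conditional second moment
matrix of the context vector given the history is the constant matrix `Sig ⪰ lamc I`, `lamc > 0`. -/
structure ContextRegularity {Ω : Type*} [MeasurableSpace Ω] (P : Measure Ω) {K : ℕ} (T : ℕ)
    (i : ℕ → Ω → Fin N) (ctx : ℕ → Fin K → Ω → EuclideanSpace ℝ (Fin d)) (η : ℕ → Ω → ℝ)
    (Sig : Matrix (Fin d) (Fin d) ℝ) (lamc : ℝ) : Prop where
  lamc_pos : 0 < lamc
  psd : (Sig - lamc • (1 : Matrix (Fin d) (Fin d) ℝ)).PosSemidef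
  secondMoment : ∀ t ∈ Finset.Icc 1 T, ∀ a : Fin K, ∀ j k : Fin d,
    P[fun ω => ctx t a ω j * ctx t a ω k | history i ctx η t] =ᵐ[P] fun _ => Sig j k

end AsyncBandit

/-!
The bound holds along every trajectory of the protocol. Write `W_j = V_g - ΔV_{-j}` for the part of
the server's statistics known to client `j`, so that `V_j = W_j + ΔV_j`. Whenever `0 < A ≤ B`, all
eigenvalues of `A^{-1/2} B A^{-1/2}` are at least `1`, so each of them is at most their product and
`B ≤ (det B / det A) A`. Hence a determinant test that does not fire is a bound in the Loewner
order: at the end of each time step `ΔV_j ≤ (γU - 1) W_j(λ)` and `V_g(λ) ≤ γD W_j(λ)`. Since the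
centralised statistics are `V_g + ∑ ΔV_j` and `W_j ≤ V_g`, the `N - 1` foreign buffers cost a factor
`1 + (N - 1)(γU - 1)` over `V_g(λ)`, and passing from `V_g(λ)` to `W_i(λ)` costs `γD`; inverting
gives `Γ ≤ γD (1 + (N - 1)(γU - 1))`. Finally, the diagonal entries of `Σ_c` lie between `λ_c` and
the squared bound on the context norms, so `1 / λ_c ≥ 1`.
-/

namespace AsyncBandit

open Matrix
open scoped ComplexOrder MatrixOrder

section Loewner

variable {n 𝕜 : Type*} [Fintype n] [DecidableEq n] [RCLike 𝕜]

theorem le_det_smul_one {A : Matrix n n 𝕜} (hA : 1 ≤ A) : A ≤ A.det • 1 := by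
  have hA' : A.IsHermitian := (nonneg_iff_posSemidef.1 (zero_le_one.trans hA)).isHermitian
  have one_le_eigenvalues k : 1 ≤ hA'.eigenvalues k :=
    (CFC.one_le_iff A hA').1 hA _ (hA'.eigenvalues_mem_spectrum_real k)
  have eigenvalues_le k : hA'.eigenvalues k ≤ ∏ l, hA'.eigenvalues l := by
    rw [← Finset.mul_prod_erase _ _ (Finset.mem_univ k)]
    exact le_mul_of_one_le_right (zero_le_one.trans (one_le_eigenvalues k))
      (Finset.one_le_prod fun l _ ↦ one_le_eigenvalues l)
  have det_smul_one : A.det • (1 : Matrix n n 𝕜) = algebraMap ℝ _ (∏ l, hA'.eigenvalues l) := by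
    rw [hA'.det_eq_prod_eigenvalues, ← RCLike.ofReal_prod, Algebra.algebraMap_eq_smul_one,
      RCLike.real_smul_eq_coe_smul (K := 𝕜)]
  rw [det_smul_one, le_algebraMap_iff_spectrum_le hA', hA'.spectrum_real_eq_range_eigenvalues]
  exact Set.forall_mem_range.2 eigenvalues_le

theorem le_det_div_det_smul {A B : Matrix n n 𝕜} (hA : A.PosDef) (hAB : A ≤ B) :
    B ≤ (B.det / A.det) • A := by
  set S := CFC.sqrt A
  have hS : 0 ≤ S := CFC.sqrt_nonneg A
  have hSS : S * S = A := CFC.sqrt_mul_sqrt_self A hA.posSemidef.nonneg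
  have hS_unit : IsUnit S.det := isUnit_of_mul_isUnit_left (y := S.det) <| by
    rw [← det_mul, hSS]
    exact hA.det_pos.ne'.isUnit
  have hS_mul_inv : S * S⁻¹ = 1 := mul_nonsing_inv S hS_unit
  have hS_inv_mul : S⁻¹ * S = 1 := nonsing_inv_mul S hS_unit
  have conj_conj_inv : S * (S⁻¹ * B * S⁻¹) * S = B := by
    simp only [mul_assoc, hS_inv_mul, mul_one, ← mul_assoc S, hS_mul_inv, one_mul]
  have det_conj : (S⁻¹ * B * S⁻¹).det = B.det / A.det := by
    rw [← hSS, det_mul, det_mul, det_mul, det_nonsing_inv, Ring.inverse_eq_inv']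
    field_simp
  have one_le_conj : 1 ≤ S⁻¹ * B * S⁻¹ := by
    have := conjugate_le_conjugate_of_nonneg hAB (nonneg_iff_posSemidef.1 hS).inv.nonneg
    rwa [← hSS, ← mul_assoc, hS_inv_mul, one_mul, hS_mul_inv] at this
  have := conjugate_le_conjugate_of_nonneg (le_det_smul_one one_le_conj) hS
  rwa [conj_conj_inv, det_conj, mul_smul_comm, mul_one, smul_mul_assoc, hSS] at this

theorem inv_le_inv_of_posDef {A B : Matrix n n 𝕜} (hA : A.PosDef) (hAB : A ≤ B) :
    B⁻¹ ≤ A⁻¹ := by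
  have hB : B.PosDef := by simpa using hA.add_posSemidef (le_iff.1 hAB)
  have := hB.isUnit.invertible
  have := hA.inv.isUnit.invertible
  -- Both inequalities say that the block matrix `[B, 1; 1, A⁻¹]` is positive semidefinite.
  have schur_left := hB.fromBlocks₁₁ 1 A⁻¹
  have schur_right := PosDef.fromBlocks₂₂ B 1 hA.inv
  rw [schur_right, nonsing_inv_nonsing_inv _ hA.det_pos.ne'.isUnit] at schur_left
  simpa [le_iff] using schur_left.1 (by simpa using le_iff.1 hAB)

theorem inv_le_smul_inv_of_le_smul {A B : Matrix n n 𝕜} {c : ℝ} (hc : 0 < c) (hA : A.PosDef)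
    (hAB : A ≤ c • B) : B⁻¹ ≤ c • A⁻¹ := by
  have inv_smul_inv : (c⁻¹ • A)⁻¹ = c • A⁻¹ := inv_eq_left_inv <| by
    rw [smul_mul_smul_comm, mul_inv_cancel₀ hc.ne', one_smul,
      nonsing_inv_mul A hA.det_pos.ne'.isUnit]
  rw [← inv_smul_inv]
  exact inv_le_inv_of_posDef (hA.smul (inv_pos.2 hc)) ((inv_smul_le_iff_of_pos hc).2 hAB)

end Loewner

variable {N d : ℕ} {lam γU γD : ℝ}

section Regularisation

variable {A B : Matrix (Fin d) (Fin d) ℝ}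

theorem quad_eq_dotProduct_mulVec (A : Matrix (Fin d) (Fin d) ℝ) (x : EuclideanSpace ℝ (Fin d)) :
    quad A x = x.ofLp ⬝ᵥ A *ᵥ x.ofLp := by
  simp only [quad, dotProduct, mulVec, Finset.mul_sum, mul_assoc]

theorem quad_nonneg (hA : 0 ≤ A) (x : EuclideanSpace ℝ (Fin d)) : 0 ≤ quad A x := by
  rw [quad_eq_dotProduct_mulVec]
  simpa using (nonneg_iff_posSemidef.1 hA).dotProduct_mulVec_nonneg x.ofLp

theorem quad_le_mul_quad {c : ℝ} (h : A ≤ c • B) (x : EuclideanSpace ℝ (Fin d)) :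
    quad A x ≤ c * quad B x := by
  have := quad_nonneg (sub_nonneg.2 h) x
  simpa only [quad_eq_dotProduct_mulVec, sub_mulVec, smul_mulVec, dotProduct_sub,
    dotProduct_smul, smul_eq_mul, sub_nonneg] using this

theorem outer_nonneg (x : EuclideanSpace ℝ (Fin d)) : 0 ≤ outer x :=
  (posSemidef_vecMulVec_self_star x.ofLp).nonneg

theorem central_nonneg (x : ℕ → EuclideanSpace ℝ (Fin d)) (t : ℕ) : 0 ≤ central x t :=
  Finset.sum_nonneg fun s _ ↦ outer_nonneg (x s)

theorem reg_add (lam : ℝ) (A B : Matrix (Fin d) (Fin d) ℝ) : reg lam (A + B) = reg lam A + B :=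
  add_right_comm A B _

theorem reg_mono (lam : ℝ) (h : A ≤ B) : reg lam A ≤ reg lam B :=
  add_le_add_left h _

theorem reg_posDef (hlam : 0 < lam) (hA : 0 ≤ A) : (reg lam A).PosDef :=
  .posSemidef_add (nonneg_iff_posSemidef.1 hA) (PosDef.one.smul hlam)

theorem reg_nonneg (hlam : 0 < lam) (hA : 0 ≤ A) : 0 ≤ reg lam A :=
  (reg_posDef hlam hA).posSemidef.nonneg

theorem reg_le_smul_reg_of_det_div_le (hlam : 0 < lam) (hA : 0 ≤ A) (hAB : A ≤ B) {c : ℝ}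
    (h : (reg lam B).det / (reg lam A).det ≤ c) : reg lam B ≤ c • reg lam A :=
  (le_det_div_det_smul (reg_posDef hlam hA) (reg_mono lam hAB)).trans
    (smul_le_smul_of_nonneg_right h (reg_nonneg hlam hA))

end Regularisation

theorem one_le_one_add_natCast_sub_one_mul (hN : 0 < N) {γ : ℝ} (hγ : 1 ≤ γ) :
    1 ≤ 1 + ((N : ℝ) - 1) * (γ - 1) :=
  le_add_of_nonneg_right
    (mul_nonneg (sub_nonneg.2 (Nat.one_le_cast.2 hN)) (sub_nonneg.2 hγ))

theorem sum_update_add {ι M : Type*} [Fintype ι] [DecidableEq ι] [AddCommMonoid M] (f : ι → M)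
    (i : ι) (a : M) : ∑ j, Function.update f i a j + f i = ∑ j, f j + a := by
  rw [Finset.sum_update_of_mem (Finset.mem_univ i), Finset.sdiff_singleton_eq_erase, add_assoc,
    Finset.sum_erase_add _ _ (Finset.mem_univ i), add_comm]

namespace ProtocolState

variable {S S' : ProtocolState N d} {i j : Fin N}

/-- The part of the server's statistics that client `j` knows. -/
def shared (S : ProtocolState N d) (j : Fin N) : Matrix (Fin d) (Fin d) ℝ :=
  S.Vg - S.down j

theorem shared_upload (S : ProtocolState N d) (i : Fin N) :
    (S.upload i).shared = Function.update S.shared i (S.shared i + S.up i) := by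
  ext1 j
  rcases eq_or_ne j i with rfl | hj
  · simp [shared, upload, sub_add_eq_add_sub]
  · simp [shared, upload, hj]

open Classical in
theorem shared_download (S : ProtocolState N d) (lam γD : ℝ) (j : Fin N) :
    (S.download lam γD).shared j = if S.DownloadEvent lam γD j then S.Vg else S.shared j := by
  split_ifs with hj <;> simp [shared, download, hj]

/-- The invariant of all protocol actions: the buffers and the shared parts are positive
semidefinite, and a client stores exactly its shared part and its upload buffer. -/
structure Consistent (S : ProtocolState N d) : Prop where
  up_nonneg : ∀ j, 0 ≤ S.up j
  down_nonneg : ∀ j, 0 ≤ S.down j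
  shared_nonneg : ∀ j, 0 ≤ S.shared j
  V_eq : ∀ j, S.V j = S.shared j + S.up j

namespace Consistent

theorem shared_le_Vg (h : S.Consistent) (j : Fin N) : S.shared j ≤ S.Vg :=
  sub_le_self _ (h.down_nonneg j)

theorem shared_le_shared_upload (h : S.Consistent) (i j : Fin N) :
    S.shared j ≤ (S.upload i).shared j := by
  rw [shared_upload]
  exact le_update_self_iff.2 (le_add_of_nonneg_right (h.up_nonneg i)) j

theorem shared_le_shared_download (h : S.Consistent) (lam γD : ℝ) (j : Fin N) :
    S.shared j ≤ (S.download lam γD).shared j := by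
  rw [shared_download]
  split_ifs
  · exact h.shared_le_Vg j
  · exact le_rfl

theorem observe (h : S.Consistent) (i : Fin N) (x : EuclideanSpace ℝ (Fin d)) :
    (S.observe i x).Consistent where
  up_nonneg j := by
    rcases eq_or_ne j i with rfl | hj
    · simpa [ProtocolState.observe] using add_nonneg (h.up_nonneg j) (outer_nonneg x)
    · simpa [ProtocolState.observe, hj] using h.up_nonneg j
  down_nonneg := h.down_nonneg
  shared_nonneg := h.shared_nonneg
  V_eq j := by
    change _ = S.shared j + _
    rcases eq_or_ne j i with rfl | hj
    · simp [ProtocolState.observe, h.V_eq j, add_assoc]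
    · simp [ProtocolState.observe, hj, h.V_eq j]

theorem upload (h : S.Consistent) (i : Fin N) : (S.upload i).Consistent where
  up_nonneg j := by
    rcases eq_or_ne j i with rfl | hj
    · simp [ProtocolState.upload]
    · simpa [ProtocolState.upload, hj] using h.up_nonneg j
  down_nonneg j := by
    rcases eq_or_ne j i with rfl | hj
    · simpa [ProtocolState.upload] using h.down_nonneg j
    · simpa [ProtocolState.upload, hj] using add_nonneg (h.down_nonneg j) (h.up_nonneg i)
  shared_nonneg j := (h.shared_nonneg j).trans (h.shared_le_shared_upload i j)
  V_eq j := by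
    rw [shared_upload]
    rcases eq_or_ne j i with rfl | hj
    · simp [ProtocolState.upload, h.V_eq j]
    · simp [ProtocolState.upload, hj, h.V_eq j]

theorem download (h : S.Consistent) (lam γD : ℝ) : (S.download lam γD).Consistent where
  up_nonneg := h.up_nonneg
  down_nonneg j := by
    by_cases hj : S.DownloadEvent lam γD j
    · simp [ProtocolState.download, hj]
    · simpa [ProtocolState.download, hj] using h.down_nonneg j
  shared_nonneg j := (h.shared_nonneg j).trans (h.shared_le_shared_download lam γD j)
  V_eq j := by
    rw [shared_download]
    by_cases hj : S.DownloadEvent lam γD j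
    · simp [ProtocolState.download, hj, h.V_eq j, shared, sub_add_eq_add_sub]
    · simp [ProtocolState.download, hj, h.V_eq j]

end Consistent

/-- The Loewner form of a failed upload test: the upload buffer of client `j` is small compared with
its shared part. Since `V_j = shared j + ΔV_j`, it says that `V_j(lam) ≤ γU • (shared j)(lam)`. -/
def UploadBounded (lam γU : ℝ) (S : ProtocolState N d) (j : Fin N) : Prop :=
  S.up j ≤ (γU - 1) • reg lam (S.shared j)

/-- The Loewner form of a failed download test: the server's statistics are comparable with the part
that client `j` knows. -/
def DownloadBounded (lam γD : ℝ) (S : ProtocolState N d) (j : Fin N) : Prop :=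
  reg lam S.Vg ≤ γD • reg lam (S.shared j)

theorem UploadBounded.mono (hγU : 1 ≤ γU) (h : UploadBounded lam γU S j)
    (hup : S'.up j = S.up j) (hshared : S.shared j ≤ S'.shared j) :
    UploadBounded lam γU S' j := by
  rw [UploadBounded, hup]
  exact h.trans (smul_le_smul_of_nonneg_left (reg_mono lam hshared) (sub_nonneg.2 hγU))

theorem Consistent.uploadBounded_of_up_eq_zero (hlam : 0 < lam) (hγU : 1 ≤ γU)
    (h : S.Consistent) (hup : S.up j = 0) : UploadBounded lam γU S j := by
  rw [UploadBounded, hup]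
  exact smul_nonneg (sub_nonneg.2 hγU) (reg_nonneg hlam (h.shared_nonneg j))

theorem Consistent.uploadBounded_of_not_uploadEvent (hlam : 0 < lam) (h : S.Consistent)
    (hj : ¬S.UploadEvent lam γU j) : UploadBounded lam γU S j := by
  rw [UploadEvent, not_lt, h.V_eq j, add_sub_cancel_right] at hj
  have := reg_le_smul_reg_of_det_div_le hlam (h.shared_nonneg j)
    (le_add_of_nonneg_right (h.up_nonneg j)) hj
  rw [UploadBounded, sub_smul, one_smul]
  rwa [reg_add, ← le_sub_iff_add_le'] at this

theorem Consistent.downloadBounded_download (hlam : 0 < lam) (hγD : 1 ≤ γD) (h : S.Consistent)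
    (j : Fin N) : DownloadBounded lam γD (S.download lam γD) j := by
  rw [DownloadBounded, shared_download]
  split_ifs with hj
  · exact le_smul_of_one_le_left
      (reg_nonneg hlam ((h.shared_nonneg j).trans (h.shared_le_Vg j))) hγD
  · exact reg_le_smul_reg_of_det_div_le hlam (h.shared_nonneg j) (h.shared_le_Vg j) (not_lt.1 hj)

/-- The invariant at the end of each time step: both failed tests hold in Loewner form for every
client. -/
structure Balanced (lam γU γD : ℝ) (S : ProtocolState N d) : Prop extends Consistent S where
  uploadBounded : ∀ j, UploadBounded lam γU S j
  downloadBounded : ∀ j, DownloadBounded lam γD S j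

theorem Consistent.balanced_communicate (hlam : 0 < lam) (hγU : 1 ≤ γU) (hγD : 1 ≤ γD)
    (h : S.Consistent) (hup : ∀ j ≠ i, UploadBounded lam γU S j)
    (hdown : ∀ j, DownloadBounded lam γD S j) :
    Balanced lam γU γD (S.communicate lam γU γD i) := by
  rw [communicate]
  split_ifs with hi
  · have h_upload := h.upload i
    have h_download := h_upload.download lam γD
    refine ⟨h_download, fun j ↦ ?_, h_upload.downloadBounded_download hlam hγD⟩
    rcases eq_or_ne j i with rfl | hj
    · exact h_download.uploadBounded_of_up_eq_zero hlam hγU (Function.update_self ..)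
    · exact (hup j hj).mono hγU (Function.update_of_ne hj ..)
        ((h.shared_le_shared_upload i j).trans (h_upload.shared_le_shared_download lam γD j))
  · refine ⟨h, fun j ↦ ?_, hdown⟩
    rcases eq_or_ne j i with rfl | hj
    · exact h.uploadBounded_of_not_uploadEvent hlam hi
    · exact hup j hj

theorem Balanced.communicate_observe (hlam : 0 < lam) (hγU : 1 ≤ γU) (hγD : 1 ≤ γD)
    (h : Balanced lam γU γD S) (i : Fin N) (x : EuclideanSpace ℝ (Fin d)) :
    Balanced lam γU γD ((S.observe i x).communicate lam γU γD i) :=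
  (h.observe i x).balanced_communicate hlam hγU hγD
    (fun j hj ↦ (h.uploadBounded j).mono hγU (Function.update_of_ne hj ..) le_rfl)
    h.downloadBounded

theorem balanced_initState (hlam : 0 < lam) (hγU : 1 ≤ γU) (hγD : 1 ≤ γD) :
    Balanced lam γU γD (initState N d) := by
  have h : (initState N d).Consistent :=
    ⟨fun _ ↦ le_rfl, fun _ ↦ le_rfl, by simp [shared, initState], by simp [shared, initState]⟩
  refine ⟨h, fun j ↦ h.uploadBounded_of_up_eq_zero hlam hγU rfl, fun j ↦ ?_⟩
  simpa [DownloadBounded, shared, initState] using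
    le_smul_of_one_le_left (reg_nonneg (d := d) hlam le_rfl) hγD

theorem Balanced.sum_up_le (hγU : 1 ≤ γU) (h : Balanced lam γU γD S) (s : Finset (Fin N)) :
    ∑ j ∈ s, S.up j ≤ (s.card * (γU - 1)) • reg lam S.Vg := by
  rw [mul_smul, Nat.cast_smul_eq_nsmul]
  exact s.sum_le_card_nsmul _ _ fun j _ ↦ (h.uploadBounded j).trans
    (smul_le_smul_of_nonneg_left (reg_mono lam (h.shared_le_Vg j)) (sub_nonneg.2 hγU))

/-- The sum of `x xᵀ` over all observations made so far: each is either still in the upload buffer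
of the client that made it or has reached the server. -/
def total (S : ProtocolState N d) : Matrix (Fin d) (Fin d) ℝ :=
  S.Vg + ∑ j, S.up j

theorem total_observe (S : ProtocolState N d) (i : Fin N) (x : EuclideanSpace ℝ (Fin d)) :
    (S.observe i x).total = S.total + outer x := by
  have sum_up : ∑ j, (S.observe i x).up j = ∑ j, S.up j + outer x := by
    have := sum_update_add S.up i (S.up i + outer x)
    rwa [add_left_comm, add_comm, add_left_cancel_iff] at this
  rw [total, sum_up, ← add_assoc]
  rfl

theorem total_upload (S : ProtocolState N d) (i : Fin N) : (S.upload i).total = S.total := by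
  have sum_up : ∑ j, (S.upload i).up j + S.up i = ∑ j, S.up j :=
    (sum_update_add S.up i 0).trans (add_zero _)
  rw [total, total, ← sum_up, ← add_assoc, add_right_comm]
  rfl

theorem total_communicate (S : ProtocolState N d) (lam γU γD : ℝ) (i : Fin N) :
    (S.communicate lam γU γD i).total = S.total := by
  rw [communicate]
  split_ifs
  · exact S.total_upload i
  · rfl

theorem Balanced.reg_total_le (hγU : 1 ≤ γU) (hγD : 1 ≤ γD) (h : Balanced lam γU γD S)
    (i : Fin N) :
    reg lam S.total ≤ (γD * (1 + ((N : ℝ) - 1) * (γU - 1))) • reg lam (S.V i) := by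
  set c : ℝ := 1 + ((N : ℝ) - 1) * (γU - 1) with hc
  have one_le_c : 1 ≤ c := one_le_one_add_natCast_sub_one_mul i.pos hγU
  have card_erase : ((Finset.univ.erase i).card : ℝ) = N - 1 := by
    simp [Finset.card_erase_of_mem, Nat.cast_pred i.pos]
  calc reg lam S.total
      = reg lam S.Vg + ∑ j ∈ Finset.univ.erase i, S.up j + S.up i := by
        rw [total, ← Finset.sum_erase_add _ _ (Finset.mem_univ i), ← add_assoc, reg_add, reg_add]
    _ ≤ reg lam S.Vg + (((N : ℝ) - 1) * (γU - 1)) • reg lam S.Vg + S.up i := by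
        grw [h.sum_up_le hγU, card_erase]
    _ = c • reg lam S.Vg + S.up i := by rw [hc, add_smul, one_smul]
    _ ≤ c • γD • reg lam (S.shared i) + (γD * c) • S.up i := by
        have hup : S.up i ≤ (γD * c) • S.up i := le_smul_of_one_le_left (h.up_nonneg i)
          (one_le_mul_of_one_le_of_one_le hγD one_le_c)
        have hVg : c • reg lam S.Vg ≤ c • γD • reg lam (S.shared i) :=
          smul_le_smul_of_nonneg_left (h.downloadBounded i) (zero_le_one.trans one_le_c)
        exact add_le_add hVg hup
    _ = (γD * c) • reg lam (S.V i) := by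
        rw [h.V_eq i, reg_add, smul_add, smul_smul, mul_comm c]

end ProtocolState

section Trajectory

variable (i : ℕ → Fin N) (x : ℕ → EuclideanSpace ℝ (Fin d)) (t : ℕ)

theorem balanced_run (hlam : 0 < lam) (hγU : 1 ≤ γU) (hγD : 1 ≤ γD) :
    (run lam γU γD i x t).Balanced lam γU γD := by
  induction t with
  | zero => exact ProtocolState.balanced_initState hlam hγU hγD
  | succ t ih => exact ih.communicate_observe hlam hγU hγD _ _

theorem total_run (lam γU γD : ℝ) : (run lam γU γD i x t).total = central x t := by
  induction t with
  | zero => simp [run, initState, ProtocolState.total, central]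
  | succ t ih =>
    rw [run, ProtocolState.total_communicate, ProtocolState.total_observe, ih, central, central,
      Finset.sum_Icc_succ_top (Nat.le_add_left 1 t)]

theorem widthRatio_le (hlam : 0 < lam) (hγU : 1 ≤ γU) (hγD : 1 ≤ γD) :
    widthRatio lam γU γD i x t ≤ γD * (1 + ((N : ℝ) - 1) * (γU - 1)) := by
  have hbal := balanced_run i x (t - 1) hlam hγU hγD
  have hle := hbal.reg_total_le hγU hγD (i t)
  rw [total_run] at hle
  have hpos : 0 < γD * (1 + ((N : ℝ) - 1) * (γU - 1)) := mul_pos (zero_lt_one.trans_le hγD)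
    (zero_lt_one.trans_le (one_le_one_add_natCast_sub_one_mul (i t).pos hγU))
  have hcentral := reg_posDef hlam (central_nonneg x (t - 1))
  exact div_le_of_le_mul₀ (quad_nonneg hcentral.inv.posSemidef.nonneg _) hpos.le
    (quad_le_mul_quad (inv_le_smul_inv_of_le_smul hpos hcentral hle) _)

end Trajectory

-- `P[f | m]` is `0` when `f` is not integrable or `m` is not a sub-σ-algebra.
theorem condExp_ae_le_const {Ω : Type*} {m m₀ : MeasurableSpace Ω} {P : Measure Ω}
    [IsFiniteMeasure P] {f : Ω → ℝ} {c : ℝ} (hc : 0 ≤ c) (hf : f ≤ᵐ[P] fun _ ↦ c) :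
    P[f | m] ≤ᵐ[P] fun _ ↦ c := by
  by_cases hm : m ≤ m₀
  · by_cases hf_int : Integrable f P
    · simpa only [condExp_const hm] using condExp_mono (m := m) hf_int (integrable_const c) hf
    · simp [condExp_of_not_integrable hf_int, Filter.EventuallyLE, hc]
  · simp [condExp_of_not_le hm, Filter.EventuallyLE, hc]

theorem ContextRegularity.lamc_le_sq {Ω : Type*} [MeasurableSpace Ω] {P : Measure Ω}
    [IsFiniteMeasure P] [NeZero P] {K T : ℕ} {i : ℕ → Ω → Fin N}
    {ctx : ℕ → Fin K → Ω → EuclideanSpace ℝ (Fin d)} {η : ℕ → Ω → ℝ}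
    {Sig : Matrix (Fin d) (Fin d) ℝ} {lamc : ℝ} (h : ContextRegularity P T i ctx η Sig lamc)
    {t : ℕ} (ht : t ∈ Finset.Icc 1 T) {a : Fin K} {L : ℝ} (hctx : ∀ᵐ ω ∂P, ‖ctx t a ω‖ ≤ L)
    (j : Fin d) : lamc ≤ L ^ 2 := by
  have lamc_le_diag : lamc ≤ Sig j j := by simpa using h.psd.diag_nonneg (i := j)
  have sq_coord_le : (fun ω ↦ ctx t a ω j * ctx t a ω j) ≤ᵐ[P] fun _ ↦ L ^ 2 := by
    filter_upwards [hctx] with ω hω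
    rw [← sq, ← sq_abs, ← Real.norm_eq_abs]
    exact pow_le_pow_left₀ (norm_nonneg _) ((PiLp.norm_apply_le _ j).trans hω) 2
  obtain ⟨ω, hle, heq⟩ :=
    ((condExp_ae_le_const (sq_nonneg L) sq_coord_le).and (h.secondMoment t ht a j j)).exists
  exact lamc_le_diag.trans (heq.ge.trans hle)

end AsyncBandit

theorem lemma1_general {Ω : Type*} [MeasurableSpace Ω] {P : Measure Ω} [IsFiniteMeasure P]
    [NeZero P] {N d K T : ℕ} {lam γU γD : ℝ} (hlam : 0 < lam) (hγU : 1 ≤ γU) (hγD : 1 ≤ γD)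
    {i : ℕ → Ω → Fin N} {ctx : ℕ → Fin K → Ω → EuclideanSpace ℝ (Fin d)} {L : ℝ}
    (hctx_le : ∀ t ∈ Finset.Icc 1 T, ∀ a, ∀ᵐ ω ∂P, ‖ctx t a ω‖ ≤ L)
    {η : ℕ → Ω → ℝ} (arm : ℕ → Ω → Fin K) {Sig : Matrix (Fin d) (Fin d) ℝ} {lamc : ℝ}
    (hreg : AsyncBandit.ContextRegularity P T i ctx η Sig lamc)
    (ω : Ω) {t : ℕ} (ht : t ∈ Finset.Icc 1 T) :
    AsyncBandit.widthRatio lam γU γD (fun s ↦ i s ω) (fun s ↦ ctx s (arm s ω) ω) t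
      ≤ γD * L ^ 2 / lamc * (1 + ((N : ℝ) - 1) * (γU - 1)) := by
  have factor_nonneg : 0 ≤ 1 + ((N : ℝ) - 1) * (γU - 1) :=
    zero_le_one.trans (AsyncBandit.one_le_one_add_natCast_sub_one_mul (i t ω).pos hγU)
  have hlamc := hreg.lamc_pos
  rcases isEmpty_or_nonempty (Fin d) with _ | ⟨⟨j⟩⟩
  · simp only [AsyncBandit.widthRatio, AsyncBandit.quad, Finset.univ_eq_empty, Finset.sum_empty,
      div_zero]
    positivity
  · have hlamc_le := hreg.lamc_le_sq ht (hctx_le t ht (arm t ω)) j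
    refine (AsyncBandit.widthRatio_le _ _ t hlam hγU hγD).trans ?_
    gcongr
    rw [le_div_iff₀ hlamc]
    gcongr

/-- For any clients' schedule and any way of choosing the arms, and for every `δ ∈ (0, 1)`, with
probability at least `1 - δ` the width ratio is bounded at all times `1 ≤ t ≤ T`. -/
theorem lemma1 {Ω : Type*} [MeasurableSpace Ω] (P : Measure Ω) [IsProbabilityMeasure P]
    (N d K T : ℕ) (lam γU γD : ℝ) (hlam : 0 < lam) (hγU : 1 ≤ γU) (hγD : 1 ≤ γD)
    -- active clients, context vectors, noises, chosen arms
    (i : ℕ → Ω → Fin N) (hi : ∀ t, Measurable (i t))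
    (ctx : ℕ → Fin K → Ω → EuclideanSpace ℝ (Fin d)) (hctx : ∀ t a, Measurable (ctx t a))
    (hctx_le : ∀ t a, ∀ᵐ ω ∂P, ‖ctx t a ω‖ ≤ 1)
    (η : ℕ → Ω → ℝ) (hη : ∀ t, Measurable (η t))
    (arm : ℕ → Ω → Fin K) (harm : ∀ t, Measurable (arm t))
    (Sig : Matrix (Fin d) (Fin d) ℝ) (lamc : ℝ)
    (hreg : AsyncBandit.ContextRegularity P T i ctx η Sig lamc)
    (δ : ℝ) (hδ0 : 0 < δ) (hδ1 : δ < 1) :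
    1 - δ ≤ P.real {ω | ∀ t ∈ Finset.Icc 1 T,
      AsyncBandit.widthRatio lam γU γD (fun s => i s ω) (fun s => ctx s (arm s ω) ω) t
        ≤ 8 * γD / lamc * (1 + ((N : ℝ) - 1) * (γU - 1))} := by
  refine (sub_le_self 1 hδ0.le).trans (probReal_univ.symm.trans_le (measureReal_mono ?_))
  intro ω _ t ht
  have factor_nonneg : 0 ≤ 1 + ((N : ℝ) - 1) * (γU - 1) :=
    zero_le_one.trans (AsyncBandit.one_le_one_add_natCast_sub_one_mul (i t ω).pos hγU)
  have lamc_pos := hreg.lamc_pos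
  refine (lemma1_general hlam hγU hγD (fun s _ ↦ hctx_le s) arm hreg ω ht).trans ?_
  rw [one_pow, mul_one]
  gcongr
  linarith
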